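/- **Setting.** A team of $p\ge 1$ robots, $V=\{1,\dots,p\}$, communicates at time $t=0,1,2,\dots$ over a directed graph $\mathcal G(t)=(V,E(t))$ with weighted adjacency matrix $A(t)=[a_{ij,t}]$, i.e. for $i\ne j$, $a_{ij,t}\neq 0$ if and only if $(i,j)\in E(t)$; let $\mathbb N_{i,t}=\{j\neq i:(i,j)\in E(t)\}$. Let $\mathcal X\subset\mathbb R^{n}$ and let $\kappa:\mathcal X\times\mathcal X\to\mathbb R$ be a covariance kernel (symmetric, positive semidefinite) with $\kappa(\mathbf x,\mathbf x)\le\sigma_f^2$ for all $\mathbf x$ (for example the squared exponential kernel $\sigma_f^2\exp(-\|\mathbf x-\mathbf x'\|^2/\ell^2)$). Let $\sigma_e,\sigma_f,\sigma_n>0$. Robot $i$ receives the data $(\mathbf x_{i,t},y_{i,t})\in\mathcal X\times\mathbb R$, $t\ge1$, and runs the recursive Gaussian process update with noise variance $\sigma_e^2$: with $\mathbf X_t=(\mathbf x_{1},\dots,\mathbf x_{t})$ its inputs so far (index $i$ omitted), $\alpha_0$ and $C_0$ empty, $k=K(\mathbf X_t,\mathbf x_{t+1})$ and $d=\sigma_e^2+\kappa(\mathbf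 x_{t+1},\mathbf x_{t+1})+k^{T}C_tk$, $$\alpha_{t+1}=\begin{bmatrix}\alpha_t\\0\end{bmatrix}+\frac{y_{t+1}-k^{T}\alpha_t}{d}\,s,\qquad C_{t+1}=\begin{bmatrix}C_t&0\\0&0\end{bmatrix}-\frac1d\,ss^{T},\qquad s=\begin{bmatrix}C_tk\\1\end{bmatrix}.$$ Its local mean and variance at a test point $\mathbf x^*\in\mathcal X$ are $\mu^{[L]}_{i,t}(\mathbf x^*)=K(\mathbf x^*,\mathbf X_t)\alpha_t$ and $\Sigma^{[L]}_{i,t}(\mathbf x^*)=\kappa(\mathbf x^*,\mathbf x^*)+K(\mathbf x^*,\mathbf X_t)C_tK(\mathbf X_t,\mathbf x^*)$, and $\hat\Sigma_{i,t}=\Sigma^{[L]}_{i,t}+\sigma_n^2$. At each test point put $\mathbf r_{i,t}=\big(\mu^{[L]}_{i,t}/\hat\Sigma_{i,t},\;1/\hat\Sigma_{i,t}\big)$, $\Delta\mathbf r_{i,0}=0$, $\Delta\mathbf r_{i,t}=\mathbf r_{i,t}-\mathbf r_{i,t-1}$, and run the first-order dynamic average consensus $$\xi_{i,t+1}=\xi_{i,t}+\sum_{j\in\mathbb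 N_{i,t}}a_{ij,t}(\xi_{j,t}-\xi_{i,t})+\Delta\mathbf r_{i,t},\qquad \xi_{i,0}=\mathbf r_{i,0}.$$ The distributed mean is $\mu^{[D]}_{i,t}=\xi^{[1]}_{i,t+1}/\xi^{[2]}_{i,t+1}$ and the centralized product-of-experts mean is $\tilde\mu_t=\sum_{i=1}^p\frac{\hat\Sigma_{i,t}^{-1}}{\sum_{k=1}^p\hat\Sigma_{k,t}^{-1}}\,\mu^{[L]}_{i,t}$. **Assumptions.** (1) There is an integer $B\ge1$ such that for every $t\ge1$ the graph $(V,E(t)\cup\dots\cup E(t+B-1))$ is strongly connected. (2) There is $\varphi>0$ such that for all $t\ge1$ and all $i$: $a_{ii,t}=1-\sum_{j\in\mathbb N_{i,t}}a_{ij,t}\ge\varphi$, $a_{ij,t}\in\{0\}\cup[\varphi,1]$ for $j\in\mathbb N_{i,t}$, and $\mathbf 1^{T}A(t)=\mathbf 1^{T}$, $A(t)\mathbf 1=\mathbf 1$. (3) There are constants $\bar y,\bar\mu$ with $|y_{i,t}|\le\bar y$ and $|\mu^{[L]}_{i,t}(\mathbf x^*)|\le\bar\mu$ for all $t\ge1$,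 $i\in V$, $\mathbf x^*\in\mathcal X$. **Theorem.** Let $$\hat\delta_1=\frac{\bar y\,\sigma_f^2(\sigma_n^2+\sigma_f^2)}{\sigma_n^2(\sigma_e^2+\sigma_f^2)}+\frac{\bar\mu\,\sigma_f^4}{\sigma_n^2(\sigma_e^2+\sigma_f^2)},\qquad \hat\delta_2=\frac{\sigma_f^4}{\sigma_n^2(\sigma_e^2+\sigma_f^2)},\qquad \eta=\frac{4(pB-1)}{\varphi^{\frac12p(p+1)B-1}},$$ and suppose $\sigma_n^2\ge\dfrac{\eta\,\sigma_f^4}{\sigma_e^2+\sigma_f^2}$. Then for every $i\in V$ and $\mathbf x^*\in\mathcal X$ the limit of $\big|\mu^{[D]}_{i,t}(\mathbf x^*)-\tilde\mu_t(\mathbf x^*)\big|$ as $t\to\infty$ exists and satisfies $$\lim_{s\to\infty}\big|\mu^{[D]}_{i,s}(\mathbf x^*)-\tilde\mu_s(\mathbf x^*)\big|\;\le\;\alpha+\beta\,|\tilde\mu_t(\mathbf x^*)|\quad\text{for all sufficiently large }t,\qquad \alpha=\frac{\eta\hat\delta_1}{1+\eta\hat\delta_2},\quad \beta=\left|\frac{\eta\hat\delta_2}{1-\eta\hat\delta_2}\right|,$$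 where in the borderline case $\eta\hat\delta_2=1$ one reads $\beta=+\infty$ and the bound is void. Furthermore, for every $\mathbf x^*\in\mathcal X$, if there is a constant $h>0$ such that $\Delta\mathbf r_{i,t+1}(\mathbf x^*)=0$ for all $t>h$ and all $i\in V$, then $\mu^{[D]}_{i,t}(\mathbf x^*)-\tilde\mu_t(\mathbf x^*)\to0$ as $t\to\infty$ for every $i\in V$. -/

import Mathlib

open Filter Topology Matrix

noncomputable section

/-! ### Recursive Gaussian process regression -/

namespace RecursiveGP

variable {S : Type*}

/-- `K(X_t, x')`: the vector of kernel values between the first `t` inputs `x_1, …, x_t`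
(the value `x 0` is never used) and the point `x'`. -/
def gramVec (κ : S → S → ℝ) (x : ℕ → S) (t : ℕ) (x' : S) : Fin t → ℝ :=
  fun k => κ (x (k + 1)) x'

/-- The vector `[v ; c]`. -/
def appendEntry {t : ℕ} (v : Fin t → ℝ) (c : ℝ) : Fin (t + 1) → ℝ :=
  Fin.snoc (α := fun _ => ℝ) v c

/-- The block matrix `[[M, 0], [0, 0]]`, with one zero row and one zero column added. -/
def padMatrix {t : ℕ} (M : Matrix (Fin t) (Fin t) ℝ) : Matrix (Fin (t + 1)) (Fin (t + 1)) ℝ :=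
  Matrix.of (Fin.snoc (α := fun _ => Fin (t + 1) → ℝ) (fun i => appendEntry (M i) 0) 0)

/-- The variables `(α_t, C_t)` of the recursive Gaussian process update for the data
`(x_1, y_1), (x_2, y_2), …` and noise variance `σe²`; before the first datum both are empty. -/
def state (κ : S → S → ℝ) (σe : ℝ) (x : ℕ → S) (y : ℕ → ℝ) :
    (t : ℕ) → (Fin t → ℝ) × Matrix (Fin t) (Fin t) ℝ
  | 0 => (0, 0)
  | t + 1 =>
    let a : Fin t → ℝ := (state κ σe x y t).1
    let C : Matrix (Fin t) (Fin t) ℝ := (state κ σe x y t).2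
    let k : Fin t → ℝ := gramVec κ x t (x (t + 1))
    let d : ℝ := σe ^ 2 + κ (x (t + 1)) (x (t + 1)) + k ⬝ᵥ (C *ᵥ k)
    let q : ℝ := (y (t + 1) - k ⬝ᵥ a) / d
    let r : ℝ := -1 / d
    let s : Fin (t + 1) → ℝ := appendEntry (C *ᵥ k) 1
    (appendEntry a 0 + q • s, padMatrix C + r • Matrix.vecMulVec s s)

/-- Predictive mean `μ_t(x') = K(x', X_t) α_t`. -/
def mean (κ : S → S → ℝ) (σe : ℝ) (x : ℕ → S) (y : ℕ → ℝ) (t : ℕ) (x' : S) : ℝ :=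
  gramVec κ x t x' ⬝ᵥ (state κ σe x y t).1

/-- Predictive variance `Σ_t(x') = κ(x', x') + K(x', X_t) C_t K(X_t, x')`. -/
def variance (κ : S → S → ℝ) (σe : ℝ) (x : ℕ → S) (y : ℕ → ℝ) (t : ℕ) (x' : S) : ℝ :=
  κ x' x' + gramVec κ x t x' ⬝ᵥ ((state κ σe x y t).2 *ᵥ gramVec κ x t x')

/-- Corrected variance `Σ_t(x') + σn²`. -/
def corrVariance (κ : S → S → ℝ) (σe σn : ℝ) (x : ℕ → S) (y : ℕ → ℝ) (t : ℕ) (x' : S) : ℝ :=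
  variance κ σe x y t x' + σn ^ 2

end RecursiveGP

/-! ### Time-varying directed networks -/

namespace Network

variable {p : ℕ}

open Classical in
/-- The neighbours of node `i` (the node itself never counts). -/
def neighbors (G : Digraph (Fin p)) (i : Fin p) : Finset (Fin p) :=
  Finset.univ.filter fun j => j ≠ i ∧ G.Adj i j

/-- The off-diagonal support of `A` is the edge set of `G`. -/
def IsWeightedAdjacency (G : Digraph (Fin p)) (A : Matrix (Fin p) (Fin p) ℝ) : Prop :=
  ∀ i j, i ≠ j → (G.Adj i j ↔ A i j ≠ 0)

/-- Every node reaches every node along a directed path. -/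
def StronglyConnected (G : Digraph (Fin p)) : Prop :=
  ∀ i j, Relation.ReflTransGen G.Adj i j

/-- For every `t ≥ 1` the union of the graphs at times `t, …, t + B - 1` is strongly connected. -/
def PeriodicallyStronglyConnected (G : ℕ → Digraph (Fin p)) (B : ℕ) : Prop :=
  ∀ t, 1 ≤ t → StronglyConnected (p := p) ⟨fun i j => ∃ k, k < B ∧ (G (t + k)).Adj i j⟩

/-- Non-degeneracy of the weights with constant `φ`, from time `1` on. -/
def NonDegenerate (G : ℕ → Digraph (Fin p)) (A : ℕ → Matrix (Fin p) (Fin p) ℝ) (φ : ℝ) : Prop :=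
  ∀ t, 1 ≤ t → ∀ i,
    A t i i = 1 - ∑ j ∈ neighbors (G t) i, A t i j ∧ φ ≤ A t i i ∧
    ∀ j ∈ neighbors (G t) i, A t i j = 0 ∨ A t i j ∈ Set.Icc φ 1

/-- Column and row sums of the weight matrices are `1`, from time `1` on. -/
def DoublyStochastic (A : ℕ → Matrix (Fin p) (Fin p) ℝ) : Prop :=
  ∀ t, 1 ≤ t → (1 : Fin p → ℝ) ᵥ* A t = 1 ∧ A t *ᵥ (1 : Fin p → ℝ) = 1

end Network

/-! ### Dynamic average consensus and aggregation at one test point -/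

namespace Aggregation

variable {p : ℕ}

/-- The increments `Δr_t = r_t - r_{t-1}` of a reference signal, with `Δr_0 = 0`. -/
def increment (r : ℕ → Fin p → Fin 2 → ℝ) : ℕ → Fin p → Fin 2 → ℝ
  | 0 => 0
  | t + 1 => r (t + 1) - r t

/-- First-order dynamic average consensus on the reference signal `r`, started at `ξ_0 = r_0`. -/
def consensus (G : ℕ → Digraph (Fin p)) (A : ℕ → Matrix (Fin p) (Fin p) ℝ)
    (r : ℕ → Fin p → Fin 2 → ℝ) : ℕ → Fin p → Fin 2 → ℝ
  | 0 => r 0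
  | t + 1 => fun i =>
      consensus G A r t i
        + ∑ j ∈ Network.neighbors (G t) i,
            A t i j • (consensus G A r t j - consensus G A r t i)
        + increment r t i

variable {S : Type*}

/-- The reference signal `r_{i,t} = (μ_{i,t} / Σ̂_{i,t}, 1 / Σ̂_{i,t})` at the test point `x'`, where
robot `i` holds the data `(x i k, y i k)`, `k ≥ 1`. -/
def reference (κ : S → S → ℝ) (σe σn : ℝ) (x : Fin p → ℕ → S) (y : Fin p → ℕ → ℝ) (x' : S) :
    ℕ → Fin p → Fin 2 → ℝ :=
  fun t i =>
    ![RecursiveGP.mean κ σe (x i) (y i) t x'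
        * (RecursiveGP.corrVariance κ σe σn (x i) (y i) t x')⁻¹,
      (RecursiveGP.corrVariance κ σe σn (x i) (y i) t x')⁻¹]

/-- The distributed mean of robot `i` at time `t`: the quotient of the two entries of `ξ_{i,t+1}`. -/
def distMean (G : ℕ → Digraph (Fin p)) (A : ℕ → Matrix (Fin p) (Fin p) ℝ)
    (κ : S → S → ℝ) (σe σn : ℝ) (x : Fin p → ℕ → S) (y : Fin p → ℕ → ℝ)
    (i : Fin p) (t : ℕ) (x' : S) : ℝ :=
  consensus G A (reference κ σe σn x y x') (t + 1) i 0
    * (consensus G A (reference κ σe σn x y x') (t + 1) i 1)⁻¹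

/-- The centralized product-of-experts mean at time `t`. -/
def poeMean (κ : S → S → ℝ) (σe σn : ℝ) (x : Fin p → ℕ → S) (y : Fin p → ℕ → ℝ)
    (t : ℕ) (x' : S) : ℝ :=
  ∑ i, (RecursiveGP.corrVariance κ σe σn (x i) (y i) t x')⁻¹
      / (∑ k, (RecursiveGP.corrVariance κ σe σn (x k) (y k) t x')⁻¹)
    * RecursiveGP.mean κ σe (x i) (y i) t x'

/-! ### The constants of the error bound -/

/-- `η = 4 (p B - 1) / φ ^ (p (p + 1) B / 2 - 1)`. -/
def eta (p B : ℕ) (φ : ℝ) : ℝ :=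
  4 * ((p : ℝ) * B - 1) / φ ^ (0.5 * (p : ℝ) * (p + 1) * B - 1 : ℝ)

/-- The constant `δ̂₁`. -/
def delta₁ (σe σf σn ybar mubar : ℝ) : ℝ :=
  ybar * σf ^ 2 * (σn ^ 2 + σf ^ 2) / (σn ^ 2 * (σe ^ 2 + σf ^ 2))
    + mubar * σf ^ 4 / (σn ^ 2 * (σe ^ 2 + σf ^ 2))

/-- The constant `δ̂₂`. -/
def delta₂ (σe σf σn : ℝ) : ℝ :=
  σf ^ 4 / (σn ^ 2 * (σe ^ 2 + σf ^ 2))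

/-- `α = η δ̂₁ / (1 + η δ̂₂)`. -/
def alphaBound (η δ₁ δ₂ : ℝ) : ℝ := η * δ₁ / (1 + η * δ₂)

/-- `β = |η δ̂₂ / (1 - η δ̂₂)|`. -/
def betaBound (η δ₂ : ℝ) : ℝ := |η * δ₂ / (1 - η * δ₂)|

end Aggregation

end

/-!
The predictive variance of a recursive Gaussian process at a fixed point is nonnegative and
nonincreasing, because each datum conditions a positive semidefinite kernel; hence it converges. Its
drop at a step is at least `gain ^ 2 * σe ^ 2`, so the gains tend to `0`, and since the innovations
are bounded the increments of the predictive mean tend to `0` as well. Thus the increments of the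
reference signals tend to `0`.

Subtracting the average over the network turns consensus into a recursion on zero-sum vectors. The
product of `p * B` consecutive weight matrices has all entries at least `φ ^ (p * B)`: each further
`B` steps enlarge the set of nodes reached from a given one until it is everything. Such a product
contracts zero-sum vectors in the sup norm, so vanishing inputs force every `ξ_{i,t+1}` towards the
average of the references at time `t`. The quotient of the two averages is the product-of-experts
mean, so the gap itself tends to `0`, below any nonnegative error bound.
-/

open scoped BigOperators

theorem tendsto_zero_of_le_mul_add {a ε : ℕ → ℝ} (ha : ∀ t, 0 ≤ a t) {ρ : ℝ} (hρ : ρ < 1)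
    (hε : Tendsto ε atTop (𝓝 0)) (hstep : ∀ t, a (t + 1) ≤ ρ * a t + ε t) :
    Tendsto a atTop (𝓝 0) := by
  wlog hρ₀ : 0 ≤ ρ generalizing ρ
  · refine this zero_lt_one (fun t => (hstep t).trans ?_) le_rfl
    gcongr
    exacts [ha t, (not_le.1 hρ₀).le]
  refine tendsto_order.2 ⟨fun b hb => .of_forall fun t => hb.trans_le (ha t), fun b hb => ?_⟩
  have hδ : 0 < b / 2 * (1 - ρ) := mul_pos (half_pos hb) (sub_pos.2 hρ)
  obtain ⟨N, hN⟩ := eventually_atTop.1 (hε.eventually_le_const hδ)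
  have hgeom (n : ℕ) : a (N + n) - b / 2 ≤ ρ ^ n * (a N - b / 2) :=
    le_geom (u := fun n => a (N + n) - b / 2) hρ₀ n fun k _ => by
      linarith [hstep (N + k), hN (N + k) (Nat.le_add_right N k), congrArg a (add_assoc N k 1)]
  have hpow : Tendsto (fun n => ρ ^ n * (a N - b / 2)) atTop (𝓝 0) := by
    simpa using (tendsto_pow_atTop_nhds_zero_of_lt_one hρ₀ hρ).mul_const (a N - b / 2)
  filter_upwards [eventually_ge_atTop N, (tendsto_sub_atTop_nat N).eventually
    (hpow.eventually_lt_const (half_pos hb))] with t hNt ht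
  have hle := hgeom (t - N)
  rw [Nat.add_sub_cancel' hNt] at hle
  linarith

theorem tendsto_zero_of_add_le_mul_add {a ε : ℕ → ℝ} (ha : ∀ t, 0 ≤ a t) {T : ℕ} (hT : T ≠ 0)
    {ρ : ℝ} (hρ : ρ < 1) (hε : Tendsto ε atTop (𝓝 0))
    (hstep : ∀ t, a (t + T) ≤ ρ * a t + ε t) : Tendsto a atTop (𝓝 0) := by
  have hresidue (k : ℕ) : Tendsto (fun n => a (T * n + k)) atTop (𝓝 0) := by
    refine tendsto_zero_of_le_mul_add (fun _ => ha _) hρ (ε := fun n => ε (T * n + k)) ?_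
      fun n => ?_
    · exact hε.comp (tendsto_atTop_mono (fun n => le_add_right (Nat.le_mul_of_pos_left n hT.bot_lt))
        tendsto_id)
    · convert! hstep (T * n + k) using 2
      ring
  exact fun s hs => Eventually.atTop_of_arithmetic hT fun k _ => hresidue k hs

theorem tendsto_div_sub_div {u v U V : ℕ → ℝ} {l c : ℝ} (hl : l ≠ 0)
    (hV : Tendsto V atTop (𝓝 l)) (hu : Tendsto (fun t => u t - U t) atTop (𝓝 0))
    (hv : Tendsto (fun t => v t - V t) atTop (𝓝 0)) (hc : ∀ᶠ t in atTop, |U t / V t| ≤ c) :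
    Tendsto (fun t => u t / v t - U t / V t) atTop (𝓝 0) := by
  have hvl : Tendsto v atTop (𝓝 l) := by simpa using hv.add hV
  have hlim := (hu.sub (bdd_le_mul_tendsto_zero' c hc hv)).div hvl hl
  rw [sub_zero, zero_div] at hlim
  refine hlim.congr' ?_
  filter_upwards [hvl.eventually_ne hl, hV.eventually_ne hl] with t hvt hVt
  simp only [Pi.div_apply]
  field_simp
  ring

theorem eq_univ_of_ne_succ {ι : Type*} [Fintype ι] {f : ℕ → Finset ι} (hf : Monotone f)
    (hne : ∀ m, f m ≠ Finset.univ → f m ≠ f (m + 1)) : f (Fintype.card ι) = Finset.univ := by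
  have hcard (m : ℕ) : f m = Finset.univ ∨ m ≤ (f m).card := by
    induction m with
    | zero => exact .inr (Nat.zero_le _)
    | succ m ih =>
      rcases eq_or_ne (f m) Finset.univ with hm | hm
      · exact .inl (Finset.univ_subset_iff.1 (hm ▸ hf m.le_succ))
      · exact .inr <| (ih.resolve_left hm).trans_lt <| Finset.card_lt_card <|
          (hf m.le_succ).lt_of_ne (hne m hm)
  exact (hcard _).elim id fun h => Finset.eq_univ_of_card _ (h.antisymm' (Finset.card_le_univ _))

namespace RecursiveGP

variable {S : Type*}

section Conditioning

variable {K : Matrix S S ℝ}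

/-- The bilinear form `(c, d) ↦ ∑ c i * K i j * d j` of a kernel on finitely supported vectors. It
carries the Cauchy–Schwarz inequality of a positive semidefinite kernel. -/
noncomputable def kernelForm (K : Matrix S S ℝ) : LinearMap.BilinForm ℝ (S →₀ ℝ) :=
  Finsupp.linearCombination ℝ fun i => Finsupp.linearCombination ℝ (K i)

theorem kernelForm_apply (K : Matrix S S ℝ) (c d : S →₀ ℝ) :
    kernelForm K c d = c.sum fun i ci => d.sum fun j dj => ci * K i j * dj := by
  simp only [kernelForm, Finsupp.linearCombination_apply, Finsupp.sum, LinearMap.sum_apply,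
    LinearMap.smul_apply, smul_eq_mul, Finset.mul_sum]
  exact Finset.sum_congr rfl fun i _ => Finset.sum_congr rfl fun j _ => by ring

theorem kernelForm_single_single (K : Matrix S S ℝ) (i j : S) :
    kernelForm K (.single i 1) (.single j 1) = K i j := by
  simp [kernelForm]

theorem kernelForm_comm (hK : K.IsSymm) (c d : S →₀ ℝ) : kernelForm K c d = kernelForm K d c := by
  have hflip : (kernelForm K).flip = kernelForm K := by
    ext i j
    simpa [kernelForm] using hK.apply i j
  exact LinearMap.congr_fun₂ hflip d c

theorem posSemidef_iff_kernelForm :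
    K.PosSemidef ↔ K.IsSymm ∧ ∀ c, 0 ≤ kernelForm K c c := by
  simp only [PosSemidef, isHermitian_iff_isSymm, kernelForm_apply, star_trivial]

/-- The covariance kernel of a centred Gaussian process with covariance `K`, conditioned on its
value at `v` observed with noise variance `s`. -/
noncomputable def condition (K : Matrix S S ℝ) (v : S) (s : ℝ) : Matrix S S ℝ :=
  of fun i j => K i j - K i v * K v j / (s + K v v)

theorem kernelForm_condition (K : Matrix S S ℝ) (v : S) (s : ℝ) (c d : S →₀ ℝ) :
    kernelForm (condition K v s) c d = kernelForm K c d
      - kernelForm K c (.single v 1) * kernelForm K (.single v 1) d / (s + K v v) := by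
  have hform : kernelForm (condition K v s) = kernelForm K - (s + K v v)⁻¹ •
      ((kernelForm K).flip (.single v 1)).smulRight (kernelForm K (.single v 1)) := by
    ext i j
    simp only [kernelForm, condition, LinearMap.coe_comp, Function.comp_apply,
      Finsupp.lsingle_apply, Finsupp.linearCombination_single, one_smul, of_apply, smul_eq_mul,
      one_mul, LinearMap.sub_apply, LinearMap.smul_apply, LinearMap.coe_smulRight,
      LinearMap.BilinForm.flip_apply, sub_right_inj]
    ring
  rw [hform]
  simp only [LinearMap.sub_apply, LinearMap.smul_apply, LinearMap.coe_smulRight,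
    LinearMap.BilinForm.flip_apply, smul_eq_mul, sub_right_inj]
  ring

theorem posSemidef_condition (hK : K.PosSemidef) (v : S) {s : ℝ} (hs : 0 < s) :
    (condition K v s).PosSemidef := by
  obtain ⟨hsymm, hnonneg⟩ := posSemidef_iff_kernelForm.1 hK
  have hd : 0 < s + K v v := add_pos_of_pos_of_nonneg hs hK.diag_nonneg
  refine posSemidef_iff_kernelForm.2 ⟨?_, fun c => ?_⟩
  · ext i j
    simp only [condition, transpose_apply, of_apply, hsymm.apply i j, hsymm.apply i v,
      hsymm.apply v j, mul_comm]
  · have hcs := LinearMap.BilinForm.apply_sq_le_of_symm (kernelForm K) hnonneg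
      ⟨kernelForm_comm hsymm⟩ c (.single v 1)
    rw [kernelForm_single_single] at hcs
    rw [kernelForm_condition, kernelForm_comm hsymm (.single v 1) c, ← sq, sub_nonneg,
      div_le_iff₀ hd]
    nlinarith [mul_nonneg hs.le (hnonneg c)]

end Conditioning

theorem appendEntry_dotProduct {t : ℕ} (v w : Fin t → ℝ) (a b : ℝ) :
    appendEntry v a ⬝ᵥ appendEntry w b = v ⬝ᵥ w + a * b := by
  simp [appendEntry, dotProduct, Fin.sum_univ_castSucc]

theorem padMatrix_mulVec {t : ℕ} (M : Matrix (Fin t) (Fin t) ℝ) (w : Fin t → ℝ) (b : ℝ) :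
    padMatrix M *ᵥ appendEntry w b = appendEntry (M *ᵥ w) 0 := by
  ext i
  cases i using Fin.lastCases <;>
    simp [padMatrix, appendEntry, mulVec, dotProduct, Fin.sum_univ_castSucc]

theorem isSymm_padMatrix {t : ℕ} {M : Matrix (Fin t) (Fin t) ℝ} (hM : M.IsSymm) :
    (padMatrix M).IsSymm := by
  ext i j
  cases i using Fin.lastCases <;> cases j using Fin.lastCases <;>
    simp [padMatrix, appendEntry, hM.apply]

theorem gramVec_succ (κ : S → S → ℝ) (x : ℕ → S) (t : ℕ) (z : S) :
    gramVec κ x (t + 1) z = appendEntry (gramVec κ x t z) (κ (x (t + 1)) z) := by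
  ext i
  cases i using Fin.lastCases <;> simp [gramVec, appendEntry]

section Recursion

variable (κ : S → S → ℝ) (σe : ℝ) (x : ℕ → S) (y : ℕ → ℝ) (t : ℕ)

/-- The predictive covariance `κ(z, w) + K(z, X_t) C_t K(X_t, w)`, a kernel whose diagonal is the
predictive variance. -/
noncomputable def covariance : Matrix S S ℝ :=
  of fun z w => κ z w + gramVec κ x t z ⬝ᵥ ((state κ σe x y t).2 *ᵥ gramVec κ x t w)

/-- The Kalman gain at `z` of the observation at time `t + 1`: the factor by which the innovation
`y (t + 1) - mean t (x (t + 1))` moves the predictive mean at `z`. -/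
noncomputable def gain (z : S) : ℝ :=
  covariance κ σe x y t z (x (t + 1)) / (σe ^ 2 + variance κ σe x y t (x (t + 1)))

theorem covariance_self (z : S) : covariance κ σe x y t z z = variance κ σe x y t z := rfl

theorem covariance_zero : covariance κ σe x y 0 = of κ := by
  ext
  simp [covariance, state]

theorem mean_zero (z : S) : mean κ σe x y 0 z = 0 := by
  simp [mean, state]

theorem variance_zero (z : S) : variance κ σe x y 0 z = κ z z := by
  simp [variance, state]

theorem isSymm_state_snd : (state κ σe x y t).2.IsSymm := by
  induction t with
  | zero => exact Subsingleton.elim _ _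
  | succ t ih => exact (isSymm_padMatrix ih).add (IsSymm.smul (transpose_vecMulVec _ _) _)

end Recursion

section Update

variable {κ : S → S → ℝ} (hsymm : (of κ).IsSymm) (σe : ℝ) (x : ℕ → S) (y : ℕ → ℝ) (t : ℕ)
include hsymm

theorem covariance_succ :
    covariance κ σe x y (t + 1) = condition (covariance κ σe x y t) (x (t + 1)) (σe ^ 2) := by
  ext z w
  have hswap : (state κ σe x y t).2 *ᵥ gramVec κ x t (x (t + 1)) ⬝ᵥ gramVec κ x t w
      = gramVec κ x t (x (t + 1)) ⬝ᵥ (state κ σe x y t).2 *ᵥ gramVec κ x t w := by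
    rw [dotProduct_mulVec, ← mulVec_transpose, isSymm_state_snd]
  have hκ : κ z (x (t + 1)) = κ (x (t + 1)) z := hsymm.apply _ _
  simp only [covariance, condition, of_apply, state, gramVec_succ, add_mulVec, padMatrix_mulVec,
    smul_mulVec, vecMulVec_mulVec, dotProduct_add, dotProduct_smul, appendEntry_dotProduct, hswap,
    hκ, smul_eq_mul, op_smul_eq_smul]
  ring

theorem mean_succ (z : S) :
    mean κ σe x y (t + 1) z = mean κ σe x y t z
      + gain κ σe x y t z * (y (t + 1) - mean κ σe x y t (x (t + 1))) := by
  have hκ : κ z (x (t + 1)) = κ (x (t + 1)) z := hsymm.apply _ _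
  simp only [mean, gain, covariance, variance, of_apply, state, gramVec_succ, dotProduct_add,
    dotProduct_smul, appendEntry_dotProduct, hκ, smul_eq_mul]
  ring

end Update

section Convergence

variable {κ : S → S → ℝ} (hκ : (of κ).PosSemidef) {σe : ℝ} (hσe : 0 < σe)
  (x : ℕ → S) (y : ℕ → ℝ)
include hκ hσe

theorem posSemidef_covariance (t : ℕ) : (covariance κ σe x y t).PosSemidef := by
  induction t with
  | zero => rwa [covariance_zero]
  | succ t ih =>
    rw [covariance_succ (isHermitian_iff_isSymm.1 hκ.1)]
    exact posSemidef_condition ih _ (pow_pos hσe 2)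

theorem variance_nonneg (t : ℕ) (z : S) : 0 ≤ variance κ σe x y t z :=
  (posSemidef_covariance hκ hσe x y t).diag_nonneg

theorem innovation_variance_pos (t : ℕ) : 0 < σe ^ 2 + variance κ σe x y t (x (t + 1)) :=
  add_pos_of_pos_of_nonneg (pow_pos hσe 2) (variance_nonneg hκ hσe x y t _)

theorem variance_succ (t : ℕ) (z : S) :
    variance κ σe x y (t + 1) z = variance κ σe x y t z
      - gain κ σe x y t z ^ 2 * (σe ^ 2 + variance κ σe x y t (x (t + 1))) := by
  have hcomm : covariance κ σe x y t (x (t + 1)) z = covariance κ σe x y t z (x (t + 1)) :=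
    (posSemidef_covariance hκ hσe x y t).1.apply z (x (t + 1))
  have hpos := innovation_variance_pos hκ hσe x y t
  rw [← covariance_self, covariance_succ (isHermitian_iff_isSymm.1 hκ.1)]
  simp only [condition, of_apply, hcomm, covariance_self, gain]
  field_simp

theorem gain_sq_mul_le (t : ℕ) (z : S) :
    gain κ σe x y t z ^ 2 * σe ^ 2 ≤ variance κ σe x y t z - variance κ σe x y (t + 1) z := by
  rw [variance_succ hκ hσe, sub_sub_cancel]
  gcongr
  exact le_add_of_nonneg_right (variance_nonneg hκ hσe x y t _)

theorem antitone_variance (z : S) : Antitone fun t => variance κ σe x y t z :=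
  antitone_nat_of_succ_le fun t => sub_nonneg.1 <|
    (by positivity : 0 ≤ gain κ σe x y t z ^ 2 * σe ^ 2).trans (gain_sq_mul_le hκ hσe x y t z)

theorem exists_tendsto_variance (z : S) :
    ∃ l, 0 ≤ l ∧ Tendsto (fun t => variance κ σe x y t z) atTop (𝓝 l) := by
  have hnonneg := fun t => variance_nonneg hκ hσe x y t z
  exact ⟨_, le_ciInf hnonneg,
    tendsto_atTop_ciInf (antitone_variance hκ hσe x y z) ⟨0, Set.forall_mem_range.2 hnonneg⟩⟩

theorem tendsto_gain (z : S) : Tendsto (fun t => gain κ σe x y t z) atTop (𝓝 0) := by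
  obtain ⟨l, -, hl⟩ := exists_tendsto_variance hκ hσe x y z
  have hdrop : Tendsto (fun t => variance κ σe x y t z - variance κ σe x y (t + 1) z)
      atTop (𝓝 0) := by
    simpa using hl.sub (hl.comp (tendsto_add_atTop_nat 1))
  have hsq := squeeze_zero (fun t => by positivity) (gain_sq_mul_le hκ hσe x y · z) hdrop
  have habs : Tendsto (fun t => |gain κ σe x y t z * σe|) atTop (𝓝 0) := by
    simpa only [← mul_pow, Real.sqrt_sq_eq_abs, Real.sqrt_zero] using hsq.sqrt
  have hmul := ((tendsto_zero_iff_abs_tendsto_zero _).2 habs).mul_const σe⁻¹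
  simpa only [mul_inv_cancel_right₀ hσe.ne', zero_mul] using hmul

theorem tendsto_mean_succ_sub {c : ℝ} (z : S)
    (hc : ∀ᶠ t in atTop, |y (t + 1) - mean κ σe x y t (x (t + 1))| ≤ c) :
    Tendsto (fun t => mean κ σe x y (t + 1) z - mean κ σe x y t z) atTop (𝓝 0) := by
  simp only [mean_succ (isHermitian_iff_isSymm.1 hκ.1), add_sub_cancel_left, mul_comm (gain ..)]
  exact bdd_le_mul_tendsto_zero' c hc (tendsto_gain hκ hσe x y z)

variable {σn : ℝ} (hσn : 0 < σn)
include hσn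

theorem corrVariance_pos (t : ℕ) (z : S) : 0 < corrVariance κ σe σn x y t z :=
  add_pos_of_nonneg_of_pos (variance_nonneg hκ hσe x y t z) (pow_pos hσn 2)

theorem exists_tendsto_inv_corrVariance (z : S) :
    ∃ l, 0 < l ∧ Tendsto (fun t => (corrVariance κ σe σn x y t z)⁻¹) atTop (𝓝 l) := by
  obtain ⟨l, hl₀, hl⟩ := exists_tendsto_variance hκ hσe x y z
  have hpos : 0 < l + σn ^ 2 := by positivity
  exact ⟨_, inv_pos.2 hpos, (hl.add_const _).inv₀ hpos.ne'⟩

end Convergence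

end RecursiveGP

namespace Network

variable {ι : Type*} [Fintype ι]

section Norm

variable [Nonempty ι] {M : Matrix ι ι ℝ}

theorem norm_mulVec_le_of_sum_row_eq (hM : ∀ i j, 0 ≤ M i j) {s : ℝ} (hs : ∀ i, ∑ j, M i j = s)
    (v : ι → ℝ) : ‖M *ᵥ v‖ ≤ s * ‖v‖ := by
  refine (pi_norm_le_iff_of_nonempty _).2 fun i => ?_
  calc ‖(M *ᵥ v) i‖
      ≤ ∑ j, ‖M i j * v j‖ := norm_sum_le _ _
    _ ≤ ∑ j, M i j * ‖v‖ := by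
        gcongr with j
        rw [norm_mul, Real.norm_of_nonneg (hM i j)]
        exact mul_le_mul_of_nonneg_left (norm_le_pi_norm v j) (hM i j)
    _ = s * ‖v‖ := by rw [← Finset.sum_mul, hs]

variable [DecidableEq ι]

theorem norm_mulVec_le (hM : M ∈ rowStochastic ℝ ι) (v : ι → ℝ) : ‖M *ᵥ v‖ ≤ ‖v‖ := by
  simpa using norm_mulVec_le_of_sum_row_eq (fun _ _ => nonneg_of_mem_rowStochastic hM)
    (sum_row_of_mem_rowStochastic hM) v

-- On zero-sum vectors `M` acts as `M - c 𝟏𝟏ᵀ`, whose entries are still nonnegative.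
theorem norm_mulVec_le_of_sum_eq_zero (hM : M ∈ rowStochastic ℝ ι) {c : ℝ}
    (hc : ∀ i j, c ≤ M i j) {v : ι → ℝ} (hv : ∑ j, v j = 0) :
    ‖M *ᵥ v‖ ≤ (1 - Fintype.card ι * c) * ‖v‖ := by
  have hsub : M *ᵥ v = (M - of fun _ _ => c) *ᵥ v := by
    ext i
    simp [mulVec, dotProduct, sub_mul, ← Finset.mul_sum, hv]
  rw [hsub]
  refine norm_mulVec_le_of_sum_row_eq (fun i j => sub_nonneg.2 (hc i j)) (fun i => ?_) v
  simp [sum_row_of_mem_rowStochastic hM]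

end Norm

theorem continuous_balance : Continuous (Fintype.balance : (ι → ℝ) → ι → ℝ) := by
  refine continuous_pi fun i => ?_
  simp only [Fintype.balance_apply, Fintype.expect_eq_sum_div_card]
  fun_prop

variable [DecidableEq ι]

/-- The product `A (s + k - 1) * ⋯ * A s`, which propagates `v ↦ A t *ᵥ v` from time `s` to time
`s + k`. -/
noncomputable def transition (A : ℕ → Matrix ι ι ℝ) (s : ℕ) : ℕ → Matrix ι ι ℝ
  | 0 => 1
  | k + 1 => A (s + k) * transition A s k

/-- Over any `B` consecutive times, every node reaches every node along entries of size at least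
`φ`. -/
def UniformlyConnected (A : ℕ → Matrix ι ι ℝ) (B : ℕ) (φ : ℝ) : Prop :=
  ∀ s i j, Relation.ReflTransGen (fun a b => ∃ k < B, φ ≤ A (s + k) a b) i j

section Averaging

variable {A : ℕ → Matrix ι ι ℝ} {B : ℕ} {φ : ℝ}

theorem transition_mem {N : Submonoid (Matrix ι ι ℝ)} (hA : ∀ t, A t ∈ N) (s k : ℕ) :
    transition A s k ∈ N := by
  induction k with
  | zero => exact N.one_mem
  | succ k ih => exact N.mul_mem (hA _) ih

theorem pow_le_transition_succ (hA : ∀ t, A t ∈ rowStochastic ℝ ι) (hφ : 0 ≤ φ) {s k : ℕ}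
    {a b j : ι} (hab : φ ≤ A (s + k) a b) (hbj : φ ^ k ≤ transition A s k b j) :
    φ ^ (k + 1) ≤ transition A s (k + 1) a j := by
  have hnonneg (l : ι) : 0 ≤ A (s + k) a l * transition A s k l j :=
    mul_nonneg (nonneg_of_mem_rowStochastic (hA _))
      (nonneg_of_mem_rowStochastic (transition_mem hA s k))
  calc φ ^ (k + 1)
      = φ * φ ^ k := pow_succ' φ k
    _ ≤ A (s + k) a b * transition A s k b j := mul_le_mul hab hbj (by positivity) (hφ.trans hab)
    _ ≤ transition A s (k + 1) a j :=
        Finset.single_le_sum (fun l _ => hnonneg l) (Finset.mem_univ b)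

open Classical in
/-- The nodes at which `transition A s k` gives node `j` a weight of at least `φ ^ k`, the least
weight of a path of length `k` with steps of weight at least `φ`. -/
noncomputable def reached (A : ℕ → Matrix ι ι ℝ) (φ : ℝ) (s : ℕ) (j : ι) (k : ℕ) : Finset ι :=
  {i | φ ^ k ≤ transition A s k i j}

theorem mem_reached {s k : ℕ} {i j : ι} :
    i ∈ reached A φ s j k ↔ φ ^ k ≤ transition A s k i j := by
  simp [reached]

theorem mem_reached_zero (s : ℕ) (j : ι) : j ∈ reached A φ s j 0 := by
  simp [mem_reached, transition]

theorem monotone_reached (hA : ∀ t, A t ∈ rowStochastic ℝ ι) (hφ : 0 ≤ φ)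
    (hdiag : ∀ t i, φ ≤ A t i i) (s : ℕ) (j : ι) : Monotone (reached A φ s j) :=
  monotone_nat_of_le_succ fun _ i hi =>
    mem_reached.2 (pow_le_transition_succ hA hφ (hdiag _ i) (mem_reached.1 hi))

theorem reached_eq_univ_of_eq_add (hA : ∀ t, A t ∈ rowStochastic ℝ ι) (hφ : 0 ≤ φ)
    (hdiag : ∀ t i, φ ≤ A t i i) (hconn : UniformlyConnected A B φ) {s m : ℕ} {j : ι}
    (hm : reached A φ s j m = reached A φ s j (m + B)) : reached A φ s j m = Finset.univ := by
  have hmono := monotone_reached hA hφ hdiag s j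
  refine Finset.eq_univ_of_forall fun i => ?_
  induction hconn (s + m) i j using Relation.ReflTransGen.head_induction_on with
  | refl => exact hmono (Nat.zero_le m) (mem_reached_zero s j)
  | head hstep _ ih =>
    obtain ⟨k, hk, hab⟩ := hstep
    have hb := mem_reached.1 (hmono (Nat.le_add_right m k) ih)
    rw [add_assoc] at hab
    rw [hm]
    exact hmono (by omega : m + k + 1 ≤ m + B)
      (mem_reached.2 (pow_le_transition_succ hA hφ hab hb))

theorem pow_le_transition (hA : ∀ t, A t ∈ rowStochastic ℝ ι) (hφ : 0 ≤ φ)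
    (hdiag : ∀ t i, φ ≤ A t i i) (hconn : UniformlyConnected A B φ) (s : ℕ) (i j : ι) :
    φ ^ (Fintype.card ι * B) ≤ transition A s (Fintype.card ι * B) i j := by
  have huniv := eq_univ_of_ne_succ (f := fun m => reached A φ s j (m * B))
    ((monotone_reached hA hφ hdiag s j).comp fun _ _ h => Nat.mul_le_mul_right B h) fun m hm heq =>
      hm (reached_eq_univ_of_eq_add hA hφ hdiag hconn (by rw [heq, Nat.succ_mul]))
  exact mem_reached.1 (huniv ▸ Finset.mem_univ i)

variable [Nonempty ι]

theorem norm_sub_transition_mulVec_le (hA : ∀ t, A t ∈ rowStochastic ℝ ι) {e w : ℕ → ι → ℝ}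
    (he : ∀ t, e (t + 1) = A t *ᵥ e t + w t) (s k : ℕ) :
    ‖e (s + k) - transition A s k *ᵥ e s‖ ≤ ∑ r ∈ Finset.range k, ‖w (s + r)‖ := by
  induction k with
  | zero => simp [transition]
  | succ k ih =>
    have hsplit : e (s + (k + 1)) - transition A s (k + 1) *ᵥ e s
        = A (s + k) *ᵥ (e (s + k) - transition A s k *ᵥ e s) + w (s + k) := by
      rw [← add_assoc, he, transition, ← mulVec_mulVec, mulVec_sub]
      abel
    rw [hsplit, Finset.sum_range_succ]
    exact (norm_add_le _ _).trans (add_le_add_left ((norm_mulVec_le (hA _) _).trans ih) _)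

theorem tendsto_zero_of_sum_eq_zero (hA : ∀ t, A t ∈ rowStochastic ℝ ι) (hφ : 0 < φ)
    (hdiag : ∀ t i, φ ≤ A t i i) (hB : B ≠ 0) (hconn : UniformlyConnected A B φ)
    {e w : ℕ → ι → ℝ} (he : ∀ t, e (t + 1) = A t *ᵥ e t + w t) (hsum : ∀ t, ∑ i, e t i = 0)
    (hw : Tendsto w atTop (𝓝 0)) : Tendsto e atTop (𝓝 0) := by
  set T := Fintype.card ι * B
  have hnoise : Tendsto (fun t => ∑ r ∈ Finset.range T, ‖w (t + r)‖) atTop (𝓝 0) := by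
    simpa using tendsto_finsetSum (Finset.range T) fun r _ =>
      (hw.comp (tendsto_add_atTop_nat r)).norm
  have hρ : 1 - Fintype.card ι * φ ^ T < 1 :=
    sub_lt_self _ (mul_pos (Nat.cast_pos.2 Fintype.card_pos) (pow_pos hφ T))
  have hT : T ≠ 0 := Nat.mul_ne_zero Fintype.card_ne_zero hB
  refine tendsto_zero_iff_norm_tendsto_zero.2 <| tendsto_zero_of_add_le_mul_add
    (fun t => norm_nonneg (e t)) hT hρ hnoise fun t => ?_
  have hcontract := norm_mulVec_le_of_sum_eq_zero (transition_mem hA t T)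
    (pow_le_transition hA hφ.le hdiag hconn t) (hsum t)
  have hdrift := norm_sub_transition_mulVec_le hA he t T
  linarith [norm_le_norm_sub_add (e (t + T)) (transition A t T *ᵥ e t)]

end Averaging

theorem balance_mulVec {M : Matrix ι ι ℝ} (hM : M ∈ doublyStochastic ℝ ι) (v : ι → ℝ) :
    Fintype.balance (M *ᵥ v) = M *ᵥ Fintype.balance v := by
  have hconst (c : ℝ) : M *ᵥ Function.const ι c = Function.const ι c := by
    rw [← mul_one c, ← smul_eq_mul, ← Function.smul_const, mulVec_smul]
    exact congrArg _ (mulVec_one_of_mem_doublyStochastic hM)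
  simp only [Fintype.balance, mulVec_sub, hconst, Fintype.expect_eq_sum_div_card,
    sum_mulVec_of_mem_doublyStochastic hM]

theorem tendsto_sub_expect {A : ℕ → Matrix ι ι ℝ} {B : ℕ} {φ : ℝ}
    (hA : ∀ t, A t ∈ doublyStochastic ℝ ι) (hφ : 0 < φ)
    (hdiag : ∀ t i, φ ≤ A t i i) (hB : B ≠ 0) (hconn : UniformlyConnected A B φ)
    {ξ u : ℕ → ι → ℝ} (hξ : ∀ t, ξ (t + 1) = A t *ᵥ ξ t + u t)
    (hu : Tendsto u atTop (𝓝 0)) (i : ι) :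
    Tendsto (fun t => ξ t i - 𝔼 j, ξ t j) atTop (𝓝 0) := by
  have : Nonempty ι := ⟨i⟩
  have hw : Tendsto (fun t => Fintype.balance (u t)) atTop (𝓝 0) := by
    simpa [Function.comp_def] using (continuous_balance.tendsto 0).comp hu
  have hrow (t : ℕ) : A t ∈ rowStochastic ℝ ι :=
    (mem_doublyStochastic_iff_mem_rowStochastic_and_mem_colStochastic.1 (hA t)).1
  have hlim := tendsto_zero_of_sum_eq_zero (e := fun t => Fintype.balance (ξ t)) hrow hφ hdiag hB
    hconn (fun t => by rw [hξ, Fintype.balance_add, balance_mulVec (hA t)])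
    (fun t => Fintype.sum_balance _) hw
  exact tendsto_pi_nhds.1 hlim i

section Weights

variable {p : ℕ} {G : ℕ → Digraph (Fin p)} {A : ℕ → Matrix (Fin p) (Fin p) ℝ} {φ : ℝ}
  (hA : ∀ t, IsWeightedAdjacency (G t) (A t)) (hφ : 0 < φ) (hnondeg : NonDegenerate G A φ)
include hA hnondeg

theorem le_entry_of_adj {t : ℕ} (ht : 1 ≤ t) {i j : Fin p} (hij : i ≠ j) (h : (G t).Adj i j) :
    φ ≤ A t i j :=
  (((hnondeg t ht i).2.2 j (by simp [neighbors, hij.symm, h])).resolve_left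
    ((hA t i j hij).1 h)).1

theorem uniformlyConnected_of_periodicallyStronglyConnected {B : ℕ}
    (hconn : PeriodicallyStronglyConnected G B) :
    UniformlyConnected (fun t => A (t + 1)) B φ := by
  intro s i j
  refine Relation.ReflTransGen.mono (fun a b ⟨k, hk, hab⟩ => ⟨k, hk, ?_⟩) _ _
    (hconn (s + 1) (Nat.le_add_left 1 s) i j)
  rw [add_right_comm] at hab
  rcases eq_or_ne a b with rfl | hne
  · exact (hnondeg _ (Nat.le_add_left 1 _) a).2.1
  · exact le_entry_of_adj hA hnondeg (Nat.le_add_left 1 _) hne hab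

include hφ

theorem mem_doublyStochastic_of_nonDegenerate (hstoch : DoublyStochastic A) {t : ℕ} (ht : 1 ≤ t) :
    A t ∈ doublyStochastic ℝ (Fin p) := by
  refine ⟨fun i j => ?_, (hstoch t ht).2, (hstoch t ht).1⟩
  rcases eq_or_ne i j with rfl | hne
  · exact hφ.le.trans (hnondeg t ht i).2.1
  · by_cases h : (G t).Adj i j
    · exact hφ.le.trans (le_entry_of_adj hA hnondeg ht hne h)
    · exact (not_not.1 (mt (hA t i j hne).2 h)).ge

end Weights

end Network

namespace Aggregation

variable {p : ℕ}

section Tracking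

variable {G : ℕ → Digraph (Fin p)} {A : ℕ → Matrix (Fin p) (Fin p) ℝ}
  (hA : ∀ t, Network.IsWeightedAdjacency (G t) (A t)) (hstoch : Network.DoublyStochastic A)
include hA hstoch

theorem consensus_succ_apply (r : ℕ → Fin p → Fin 2 → ℝ) {t : ℕ} (ht : 1 ≤ t) (i : Fin p)
    (c : Fin 2) :
    consensus G A r (t + 1) i c
      = (A t *ᵥ fun j => consensus G A r t j c) i + increment r t i c := by
  have hrow : ∑ j, A t i j = 1 := by
    simpa [mulVec, dotProduct] using congrFun (hstoch t ht).2 i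
  have hsum : ∑ j ∈ Network.neighbors (G t) i,
        A t i j * (consensus G A r t j c - consensus G A r t i c)
      = ∑ j, A t i j * (consensus G A r t j c - consensus G A r t i c) := by
    refine Finset.sum_subset (Finset.subset_univ _) fun j _ hj => ?_
    rcases eq_or_ne j i with rfl | hne
    · rw [sub_self, mul_zero]
    · have hadj : ¬(G t).Adj i j := fun h => hj (by simp [Network.neighbors, hne, h])
      rw [not_not.1 (mt (hA t i j hne.symm).2 hadj), zero_mul]
  simp only [consensus, Pi.add_apply, Finset.sum_apply, Pi.smul_apply, Pi.sub_apply, smul_eq_mul,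
    hsum]
  simp only [mul_sub, Finset.sum_sub_distrib, ← Finset.sum_mul, hrow, mulVec, dotProduct]
  ring

-- The weights at time `0` are unconstrained; the total survives that step only because the
-- differences of equal initial values vanish.
theorem sum_consensus_succ {r : ℕ → Fin p → Fin 2 → ℝ} (hr : ∀ i j, r 0 i = r 0 j) (c : Fin 2)
    (t : ℕ) : ∑ i, consensus G A r (t + 1) i c = ∑ i, r t i c := by
  induction t with
  | zero =>
    refine Finset.sum_congr rfl fun i _ => ?_
    simp [consensus, increment, fun j => hr j i]
  | succ t ih =>
    have hcol : ∑ i, (A (t + 1) *ᵥ fun j => consensus G A r (t + 1) j c) i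
        = ∑ j, consensus G A r (t + 1) j c := by
      have := dotProduct_mulVec (1 : Fin p → ℝ) (A (t + 1)) fun j => consensus G A r (t + 1) j c
      rwa [(hstoch (t + 1) (Nat.le_add_left 1 t)).1, one_dotProduct, one_dotProduct] at this
    simp only [consensus_succ_apply hA hstoch r (Nat.le_add_left 1 t), Finset.sum_add_distrib,
      hcol, ih, increment, Pi.sub_apply, Finset.sum_sub_distrib, add_sub_cancel]

theorem tendsto_consensus_sub_expect {B : ℕ} (hB : 1 ≤ B)
    (hconn : Network.PeriodicallyStronglyConnected G B) {φ : ℝ} (hφ : 0 < φ)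
    (hnondeg : Network.NonDegenerate G A φ) {r : ℕ → Fin p → Fin 2 → ℝ}
    (hr : ∀ i j, r 0 i = r 0 j) (c : Fin 2)
    (hinc : ∀ i, Tendsto (fun t => r (t + 1) i c - r t i c) atTop (𝓝 0)) (i : Fin p) :
    Tendsto (fun t => consensus G A r (t + 1) i c - 𝔼 j, r t j c) atTop (𝓝 0) := by
  have hlim := Network.tendsto_sub_expect (A := fun t => A (t + 1))
    (ξ := fun t j => consensus G A r (t + 1) j c) (u := fun t j => r (t + 1) j c - r t j c)
    (fun t => Network.mem_doublyStochastic_of_nonDegenerate hA hφ hnondeg hstoch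
      (Nat.le_add_left 1 t))
    hφ (fun t i => (hnondeg _ (Nat.le_add_left 1 t) i).2.1) (Nat.one_le_iff_ne_zero.1 hB)
    (Network.uniformlyConnected_of_periodicallyStronglyConnected hA hnondeg hconn)
    (fun t => funext fun j => consensus_succ_apply hA hstoch r (Nat.le_add_left 1 t) j c)
    (tendsto_pi_nhds.2 hinc) i
  simpa only [Fintype.expect_eq_sum_div_card, sum_consensus_succ hA hstoch hr] using hlim

end Tracking

section Reference

variable {S : Type*} {κ : S → S → ℝ} {σe σn : ℝ}

theorem reference_zero (x : Fin p → ℕ → S) (y : Fin p → ℕ → ℝ) (z : S) (i : Fin p) :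
    reference κ σe σn x y z 0 i = ![0, (κ z z + σn ^ 2)⁻¹] := by
  simp [reference, RecursiveGP.mean_zero, RecursiveGP.corrVariance, RecursiveGP.variance_zero]

theorem poeMean_eq_div [Nonempty (Fin p)] (x : Fin p → ℕ → S) (y : Fin p → ℕ → ℝ) (t : ℕ) (z : S) :
    poeMean κ σe σn x y t z
      = (𝔼 i, reference κ σe σn x y z t i 0) / 𝔼 i, reference κ σe σn x y z t i 1 := by
  have hcard : (Fintype.card (Fin p) : ℝ) ≠ 0 := Nat.cast_ne_zero.2 Fintype.card_ne_zero
  rw [Fintype.expect_eq_sum_div_card, Fintype.expect_eq_sum_div_card,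
    div_div_div_cancel_right₀ hcard, Finset.sum_div]
  refine Finset.sum_congr rfl fun i _ => ?_
  simp only [reference, cons_val_zero, cons_val_one]
  ring

variable (hκ : (of κ).PosSemidef) (hσe : 0 < σe) (hσn : 0 < σn)
  (x : Fin p → ℕ → S) (y : Fin p → ℕ → ℝ)
include hκ hσe hσn

theorem abs_poeMean_le [Nonempty (Fin p)] {mubar : ℝ} {t : ℕ} {z : S}
    (hmu : ∀ i, |RecursiveGP.mean κ σe (x i) (y i) t z| ≤ mubar) :
    |poeMean κ σe σn x y t z| ≤ mubar := by
  have hpos (i : Fin p) := inv_pos.2 (RecursiveGP.corrVariance_pos hκ hσe (x i) (y i) hσn t z)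
  have hsum := Finset.sum_pos (fun i _ => hpos i) Finset.univ_nonempty
  refine abs_le.2 <| (convex_Icc (-mubar) mubar).sum_mem (fun i _ => (div_pos (hpos i) hsum).le) ?_
    fun i _ => abs_le.1 (hmu i)
  rw [← Finset.sum_div, div_self hsum.ne']

theorem tendsto_reference_succ_sub {z : S} {i : Fin p} {ybar mubar : ℝ}
    (hy : ∀ t, 1 ≤ t → |y i t| ≤ ybar)
    (hmu : ∀ t, 1 ≤ t → ∀ z, |RecursiveGP.mean κ σe (x i) (y i) t z| ≤ mubar) (c : Fin 2) :
    Tendsto (fun t => reference κ σe σn x y z (t + 1) i c - reference κ σe σn x y z t i c)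
      atTop (𝓝 0) := by
  have hbound : ∀ᶠ t in atTop, ∀ z, |RecursiveGP.mean κ σe (x i) (y i) t z| ≤ mubar :=
    eventually_atTop.2 ⟨1, hmu⟩
  have hmean : Tendsto (fun t => RecursiveGP.mean κ σe (x i) (y i) (t + 1) z
      - RecursiveGP.mean κ σe (x i) (y i) t z) atTop (𝓝 0) := by
    refine RecursiveGP.tendsto_mean_succ_sub hκ hσe (x i) (y i) z (c := ybar + mubar) ?_
    filter_upwards [hbound] with t ht
    exact (abs_sub _ _).trans (add_le_add (hy _ (Nat.le_add_left 1 t)) (ht _))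
  obtain ⟨l, -, hl⟩ := RecursiveGP.exists_tendsto_inv_corrVariance hκ hσe (x i) (y i) hσn z
  have hl' := hl.comp (tendsto_add_atTop_nat 1)
  have hprecision := hl'.sub hl
  rw [sub_self] at hprecision
  match c with
  | 0 =>
    have hlim := (hmean.mul hl').add
      (bdd_le_mul_tendsto_zero' mubar (hbound.mono fun t ht => ht z) hprecision)
    rw [zero_mul, add_zero] at hlim
    refine hlim.congr fun t => ?_
    simp only [Function.comp_apply, reference, cons_val_zero]
    ring
  | 1 => exact hprecision

theorem exists_tendsto_expect_reference [Nonempty (Fin p)] (z : S) :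
    ∃ l ≠ 0, Tendsto (fun t => 𝔼 i, reference κ σe σn x y z t i 1) atTop (𝓝 l) := by
  choose l hl₀ hl using fun i =>
    RecursiveGP.exists_tendsto_inv_corrVariance hκ hσe (x i) (y i) hσn z
  refine ⟨𝔼 i, l i, (Finset.expect_pos (fun i _ => hl₀ i) Finset.univ_nonempty).ne', ?_⟩
  simp only [Fintype.expect_eq_sum_div_card]
  exact (tendsto_finsetSum _ fun i _ => hl i).div_const _

end Reference

theorem eta_nonneg {B : ℕ} (hp : 1 ≤ p) (hB : 1 ≤ B) {φ : ℝ} (hφ : 0 < φ) : 0 ≤ eta p B φ := by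
  have hpB : (1 : ℝ) ≤ p * B := by exact_mod_cast Nat.mul_pos hp hB
  exact div_nonneg (by linarith) (Real.rpow_nonneg hφ.le _)

theorem errorBound_nonneg {η σe σf σn ybar mubar : ℝ} (hη : 0 ≤ η) (hy : 0 ≤ ybar)
    (hmu : 0 ≤ mubar) (m : ℝ) :
    0 ≤ alphaBound η (delta₁ σe σf σn ybar mubar) (delta₂ σe σf σn)
      + betaBound η (delta₂ σe σf σn) * |m| := by
  unfold alphaBound betaBound delta₁ delta₂
  positivity

end Aggregation

theorem theorem1_general {p : ℕ} {G : ℕ → Digraph (Fin p)} {A : ℕ → Matrix (Fin p) (Fin p) ℝ}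
    (hA : ∀ t, Network.IsWeightedAdjacency (G t) (A t))
    {B : ℕ} (hB : 1 ≤ B) (hconn : Network.PeriodicallyStronglyConnected G B)
    {φ : ℝ} (hφ : 0 < φ) (hnondeg : Network.NonDegenerate G A φ)
    (hstoch : Network.DoublyStochastic A)
    {S : Type*} {κ : S → S → ℝ} {σe σn : ℝ} (hσe : 0 < σe) (hσn : 0 < σn)
    (hκ : (of κ).PosSemidef)
    {x : Fin p → ℕ → S} {y : Fin p → ℕ → ℝ}
    {ybar mubar : ℝ} (hy : ∀ i t, 1 ≤ t → |y i t| ≤ ybar)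
    (hmu : ∀ i t, 1 ≤ t → ∀ z, |RecursiveGP.mean κ σe (x i) (y i) t z| ≤ mubar)
    (i : Fin p) (z : S) :
    Tendsto (fun t => Aggregation.distMean G A κ σe σn x y i t z
      - Aggregation.poeMean κ σe σn x y t z) atTop (𝓝 0) := by
  have : Nonempty (Fin p) := ⟨i⟩
  have track (c : Fin 2) := Aggregation.tendsto_consensus_sub_expect hA hstoch hB hconn hφ hnondeg
    (fun j k => by simp only [Aggregation.reference_zero]) c
    (fun j => Aggregation.tendsto_reference_succ_sub (z := z) hκ hσe hσn x y (hy j) (hmu j) c) i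
  obtain ⟨l, hl₀, hl⟩ := Aggregation.exists_tendsto_expect_reference hκ hσe hσn x y z
  simp only [Aggregation.distMean, ← div_eq_mul_inv, Aggregation.poeMean_eq_div]
  refine tendsto_div_sub_div hl₀ hl (track 0) (track 1) (c := mubar) ?_
  filter_upwards [eventually_ge_atTop 1] with t ht
  rw [← Aggregation.poeMean_eq_div]
  exact Aggregation.abs_poeMean_le hκ hσe hσn x y fun j => hmu j t ht z

theorem theorem1
    -- the team of robots, its graphs and its weights
    (p : ℕ) (hp : 1 ≤ p)
    (G : ℕ → Digraph (Fin p)) (A : ℕ → Matrix (Fin p) (Fin p) ℝ)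
    (hA : ∀ t, Network.IsWeightedAdjacency (G t) (A t))
    (B : ℕ) (hB : 1 ≤ B) (hconn : Network.PeriodicallyStronglyConnected G B)
    (φ : ℝ) (hφ : 0 < φ) (hnondeg : Network.NonDegenerate G A φ)
    (hstoch : Network.DoublyStochastic A)
    -- the Gaussian process model: a covariance kernel with variances at most `σf ^ 2`
    (n : ℕ) (X : Set (EuclideanSpace ℝ (Fin n)))
    (κ : X → X → ℝ) (σe σf σn : ℝ) (hσe : 0 < σe) (hσf : 0 < σf) (hσn : 0 < σn)
    (hκ : (Matrix.of κ).PosSemidef) (hκσ : ∀ z, κ z z ≤ σf ^ 2)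
    -- the data stream of each robot, bounded together with the local predictions
    (x : Fin p → ℕ → X) (y : Fin p → ℕ → ℝ)
    (ybar mubar : ℝ) (hy : ∀ i t, 1 ≤ t → |y i t| ≤ ybar)
    (hmu : ∀ i t, 1 ≤ t → ∀ z, |RecursiveGP.mean κ σe (x i) (y i) t z| ≤ mubar)
    -- the choice of the correction bias
    (hbias : Aggregation.eta p B φ * σf ^ 4 / (σe ^ 2 + σf ^ 2) ≤ σn ^ 2) :
    -- the gap converges, and its limit obeys the error bound (void if `β` is infinite)
    (∀ (i : Fin p) (z : X), ∃ gap : ℝ,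
      Tendsto (fun t => |Aggregation.distMean G A κ σe σn x y i t z
          - Aggregation.poeMean κ σe σn x y t z|) atTop (𝓝 gap) ∧
      (Aggregation.eta p B φ * Aggregation.delta₂ σe σf σn ≠ 1 →
        ∀ᶠ t in atTop,
          gap ≤ Aggregation.alphaBound (Aggregation.eta p B φ)
                  (Aggregation.delta₁ σe σf σn ybar mubar) (Aggregation.delta₂ σe σf σn)
              + Aggregation.betaBound (Aggregation.eta p B φ) (Aggregation.delta₂ σe σf σn)
                  * |Aggregation.poeMean κ σe σn x y t z|)) ∧
    -- if the reference inputs eventually vanish, then the gap tends to zero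
    (∀ z : X,
      (∃ h : ℕ, 0 < h ∧ ∀ t, h < t → ∀ i,
        Aggregation.increment (Aggregation.reference κ σe σn x y z) (t + 1) i = 0) →
      ∀ i : Fin p,
        Tendsto (fun t => Aggregation.distMean G A κ σe σn x y i t z
          - Aggregation.poeMean κ σe σn x y t z) atTop (𝓝 0)) := by
  have key := theorem1_general hA hB hconn hφ hnondeg hstoch hσe hσn hκ hy hmu
  refine ⟨fun i z => ⟨0, by simpa using (key i z).abs, fun _ => .of_forall fun t => ?_⟩,
    fun z _ i => key i z⟩
  exact Aggregation.errorBound_nonneg (Aggregation.eta_nonneg hp hB hφ)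
    ((abs_nonneg _).trans (hy i 1 le_rfl)) ((abs_nonneg _).trans (hmu i 1 le_rfl z)) _
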